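/- Work on a word RAM: memory cells and registers hold words of $w=b(\lfloor\log_2 n\rfloor+1)$ bits for a constant $b$, and each of the usual instructions (arithmetic, bitwise and shift operations, indirect memory access, comparison jumps) takes unit time. An approximate distance oracle (ADO) for a graph $G$ on the vertices $0,\dots,n-1$ consists of a query program and an array of words (its length is the space of the ADO), such that the program, given vertices $u,v$ and access to the array, returns an estimate $\hat d(u,v)\in\mathbb N\cup\{\infty\}$. Let $d(u,v)$ be the distance in $G$ ($\infty$ if there is no path). The ADO has $(\alpha,\beta)$-stretch if $d(u,v)\le\hat d(u,v)\le\max\{d(u,v),\ \alpha\, d(u,v)+\beta\}$ for all $u,v$, where the right-hand side is read as $\infty$ when $d(u,v)=\infty$. Theorem. There are a query program and constants $t,b,a\in\mathbb N$ and $C\in\mathbb R$, all absolute, such that the following holds. Let $k\ge 1$ be an integer, let $c>0$ and $0<\varepsilon\le 1/k$ be real numbers, and let $G$ be a finite simple undirected unweighted graph with $n$ vertices and maximum degree $\Delta_G\le c\,n^{1/k-\varepsilon}$. Then there is an array of at most $$C\cdot\max\{1,c^k\}\cdot n^{2-k\varepsilon/3}\cdot(1+\log n)^a$$ words which, together with the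 program, forms an ADO for $G$ with $(2,1-k)$-stretch that answers every query in at most $t$ steps. In particular, for constant $c$ and $k$ the space is $\tilde O(c^k n^{2-k\varepsilon/3})$, and the hidden constant is absolute when $c\ge 1$. -/

import Mathlib

/-! A word RAM with a step count, and approximate distance oracles run on it. -/

namespace WordRAM

/-- Arithmetic and bitwise operations on machine words; all take unit time. -/
inductive BinOp where
  | add | sub | mul | div | mod | and | or | xor | shl | shr

/-- The value of an operation on `w`-bit words: unsigned, `add`, `sub`, `mul` modulo `2 ^ w`. -/
def BinOp.apply {w : ℕ} : BinOp → BitVec w → BitVec w → BitVec w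
  | .add, x, y => x + y
  | .sub, x, y => x - y
  | .mul, x, y => x * y
  | .div, x, y => x / y
  | .mod, x, y => x % y
  | .and, x, y => x &&& y
  | .or, x, y => x ||| y
  | .xor, x, y => x ^^^ y
  | .shl, x, y => x <<< y
  | .shr, x, y => x >>> y

/-- Instructions. Registers and jump targets are given by fixed numbers in the program;
memory is addressed indirectly through a register. -/
inductive Instr where
  /-- `const d m`: write the constant `m` to register `d`. -/
  | const (d m : ℕ)
  /-- `op o d i j`: write the value of `o` on registers `i`, `j` to register `d`. -/
  | op (o : BinOp) (d i j : ℕ)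
  /-- `load d i`: write to register `d` the memory cell whose address is in register `i`. -/
  | load (d i : ℕ)
  /-- `jumpEq i j l`: go to line `l` if registers `i` and `j` are equal. -/
  | jumpEq (i j l : ℕ)
  /-- `jumpLt i j l`: go to line `l` if register `i` is smaller than register `j`. -/
  | jumpLt (i j l : ℕ)
  /-- `halt i`: stop and return the content of register `i`. -/
  | halt (i : ℕ)

/-- A program is a finite list of instructions; it does not depend on the input or word size. -/
abbrev Program := List Instr

/-- Run `P` from line `pc` with registers `R` for at most `t` steps (one instruction per step) on
the read-only memory `D` of `w`-bit words. The result is the returned word, or `none` if the program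
does not halt within `t` steps or leaves its text. Addresses outside `D` read as zero. -/
def Program.eval {w : ℕ} (P : Program) (D : List (BitVec w)) :
    ℕ → ℕ → (ℕ → BitVec w) → Option (BitVec w)
  | 0, _, _ => none
  | t + 1, pc, R =>
    match P[pc]? with
    | none => none
    | some (.const d m) => Program.eval P D t (pc + 1) (Function.update R d (BitVec.ofNat w m))
    | some (.op o d i j) =>
        Program.eval P D t (pc + 1) (Function.update R d (o.apply (R i) (R j)))
    | some (.load d i) =>
        Program.eval P D t (pc + 1) (Function.update R d (D.getD (R i).toNat 0))
    | some (.jumpEq i j l) => Program.eval P D t (if R i = R j then l else pc + 1) R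
    | some (.jumpLt i j l) =>
        Program.eval P D t (if (R i).toNat < (R j).toNat then l else pc + 1) R
    | some (.halt i) => some (R i)

/-- Answer to the query `(u, v)` within `t` steps: register `0` starts as `u`, register `1` as `v`,
all other registers as zero. -/
def Program.query {w : ℕ} (P : Program) (D : List (BitVec w)) (t u v : ℕ) : Option (BitVec w) :=
  P.eval D t 0 fun i =>
    if i = 0 then BitVec.ofNat w u else if i = 1 then BitVec.ofNat w v else 0

/-- The distance represented by a word: the all-ones word stands for `∞` (no path), every other word
for its value. -/
def toDistance {w : ℕ} (x : BitVec w) : ℕ∞ :=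
  if x = BitVec.allOnes w then ⊤ else (x.toNat : ℕ∞)

/-- The estimate `e` of the distance `d` satisfies `d ≤ e ≤ max {d, α d + β}`. For `d = ∞` the upper
bound is void and the lower bound says `e = ∞`; for finite `d` the estimate has to be finite. -/
def HasStretch (α β : ℝ) (d e : ℕ∞) : Prop :=
  d ≤ e ∧ ∀ m : ℕ, d = (m : ℕ∞) →
    ∃ q : ℕ, e = (q : ℕ∞) ∧ (q : ℝ) ≤ max (m : ℝ) (α * (m : ℝ) + β)

/-- The words `D`, with the query program `P`, form an approximate distance oracle for `G` with
`(α, β)`-stretch which answers every query within `t` steps. -/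
def IsDistanceOracle {n w : ℕ} (G : SimpleGraph (Fin n)) (P : Program) (D : List (BitVec w))
    (t : ℕ) (α β : ℝ) : Prop :=
  ∀ u v : Fin n, ∃ x : BitVec w,
    P.query D t (u : ℕ) (v : ℕ) = some x ∧ HasStretch α β (G.edist u v) (toDistance x)

end WordRAM

section Landmarks

variable {V : Type*} [Fintype V] [DecidableEq V]

/-- The vertices `v` that are closer to `w` than to every landmark in `A`. -/
def cluster (d : V → V → ℕ∞) (A : Finset V) (w : V) : Finset V :=
  {v | ∀ a ∈ A, d w v < d a v}

/-- The vertices whose cluster has more than `M` elements. -/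
def overfull (d : V → V → ℕ∞) (M : ℕ) (A : Finset V) : Finset V :=
  {w | M < (cluster d A w).card}

/-- The total size of the overfull clusters. -/
def excess (d : V → V → ℕ∞) (M : ℕ) (A : Finset V) : ℕ :=
  ∑ w ∈ overfull d M A, (cluster d A w).card

/-- Vertices with an overfull cluster that contains `v`. -/
def overfullBunch (d : V → V → ℕ∞) (M : ℕ) (A : Finset V) (v : V) : Finset V :=
  {w ∈ overfull d M A | v ∈ cluster d A w}

theorem cluster_insert (d : V → V → ℕ∞) (A : Finset V) (a w : V) :
    cluster d (insert a A) w = {v ∈ cluster d A w | d w v < d a v} := by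
  ext v
  simp [cluster, and_comm]

theorem overfull_insert_subset (d : V → V → ℕ∞) (M : ℕ) (A : Finset V) (a : V) :
    overfull d M (insert a A) ⊆ overfull d M A := by
  intro w hw
  simp only [overfull, Finset.mem_filter, Finset.mem_univ, true_and, cluster_insert] at hw ⊢
  exact hw.trans_le (Finset.card_filter_le _ _)

theorem excess_eq_sum_overfullBunch (d : V → V → ℕ∞) (M : ℕ) (A : Finset V) :
    excess d M A = ∑ v, (overfullBunch d M A v).card := by
  simp only [excess, overfullBunch, Finset.card_filter]
  rw [Finset.sum_comm]
  refine Finset.sum_congr rfl fun w _ => ?_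
  rw [← Finset.card_filter, Finset.filter_univ_mem]

theorem excess_insert_add_le (d : V → V → ℕ∞) (M : ℕ) (A : Finset V) (a : V) :
    excess d M (insert a A) + ∑ v, ((overfullBunch d M A v).filter fun w => d a v ≤ d w v).card ≤
      excess d M A := by
  have h1 : excess d M (insert a A) ≤
      ∑ v, ((overfullBunch d M A v).filter fun w => ¬ d a v ≤ d w v).card := by
    rw [excess_eq_sum_overfullBunch]
    refine Finset.sum_le_sum fun v _ => Finset.card_le_card fun w hw => ?_
    simp only [overfullBunch, Finset.mem_filter, cluster_insert, not_le] at hw ⊢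
    exact ⟨⟨overfull_insert_subset d M A a hw.1, hw.2.1⟩, hw.2.2⟩
  rw [excess_eq_sum_overfullBunch d M A]
  refine (Nat.add_le_add_right h1 _).trans_eq ?_
  rw [← Finset.sum_add_distrib]
  refine Finset.sum_congr rfl fun v _ => ?_
  rw [add_comm, Finset.card_filter_add_card_filter_not]

theorem card_sq_le_two_mul_card_le_pairs {ι : Type*} (s : Finset ι) (f : ι → ℕ∞) :
    s.card ^ 2 ≤ 2 * ∑ a ∈ s, (s.filter fun w => f a ≤ f w).card := by
  have h : ∑ a ∈ s, (s.filter fun w => f a ≤ f w).card =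
      ∑ a ∈ s, (s.filter fun w => f w ≤ f a).card := by
    simp only [Finset.card_filter]
    exact Finset.sum_comm
  have h2 : s.card ^ 2 ≤ ∑ a ∈ s, ((s.filter fun w => f a ≤ f w).card +
      (s.filter fun w => f w ≤ f a).card) := by
    rw [sq, ← smul_eq_mul]
    refine Finset.card_nsmul_le_sum _ _ _ fun a _ => ?_
    rw [← Finset.card_filter_add_card_filter_not (s := s) (fun w => f a ≤ f w)]
    refine Nat.add_le_add_left (Finset.card_le_card fun w hw => ?_) _
    simp only [Finset.mem_filter, not_le] at hw ⊢
    exact ⟨hw.1, hw.2.le⟩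
  rw [Finset.sum_add_distrib, ← h] at h2
  omega

theorem exists_excess_insert_le (d : V → V → ℕ∞) (M : ℕ) (A : Finset V)
    (h : (overfull d M A).Nonempty) :
    ∃ a, (excess d M (insert a A) : ℝ) ≤
      excess d M A * (1 - (M : ℝ) / (2 * Fintype.card V)) := by
  set W := overfull d M A with hW
  set Φ := excess d M A with hΦ
  by_contra! hcon
  have hn : (0 : ℝ) < Fintype.card V := by
    obtain ⟨w, -⟩ := h
    exact_mod_cast Fintype.card_pos_iff.2 ⟨w⟩
  have hm : (0 : ℝ) < W.card := by exact_mod_cast h.card_pos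
  have hMm : W.card * M ≤ Φ := by
    rw [hΦ, excess, ← smul_eq_mul]
    refine Finset.card_nsmul_le_sum _ _ _ fun w hw => ?_
    exact (Finset.mem_filter.1 hw).2.le
  have hΦ0 : (0 : ℝ) ≤ Φ := Nat.cast_nonneg _
  have hsq : Φ ^ 2 ≤ Fintype.card V * ∑ v, (overfullBunch d M A v).card ^ 2 := by
    rw [hΦ, excess_eq_sum_overfullBunch]
    exact sq_sum_le_card_mul_sum_sq
  have hpairs : ∑ v, (overfullBunch d M A v).card ^ 2 ≤
      2 * ∑ a ∈ W, ∑ v, ((overfullBunch d M A v).filter fun w => d a v ≤ d w v).card := by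
    rw [Finset.sum_comm, Finset.mul_sum]
    refine Finset.sum_le_sum fun v _ => ?_
    refine (card_sq_le_two_mul_card_le_pairs _ fun w => d w v).trans ?_
    refine Nat.mul_le_mul_left _ (Finset.sum_le_sum_of_subset ?_)
    exact Finset.filter_subset _ _
  have hsum : ∑ a ∈ W, excess d M (insert a A) +
      ∑ a ∈ W, ∑ v, ((overfullBunch d M A v).filter fun w => d a v ≤ d w v).card ≤
      W.card * Φ := by
    rw [← Finset.sum_add_distrib, ← smul_eq_mul]
    exact Finset.sum_le_card_nsmul _ _ _ fun a _ => excess_insert_add_le d M A a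
  have hlow : (W.card : ℝ) * (Φ * (1 - (M : ℝ) / (2 * Fintype.card V))) <
      ∑ a ∈ W, (excess d M (insert a A) : ℝ) := by
    rw [← nsmul_eq_mul]
    have := Finset.sum_lt_sum_of_nonempty h (fun a _ => hcon a)
    simpa using this
  set E := ∑ a ∈ W, ∑ v, ((overfullBunch d M A v).filter fun w => d a v ≤ d w v).card
  have hsq' : (Φ : ℝ) ^ 2 ≤ Fintype.card V * (2 * E) := by
    exact_mod_cast hsq.trans (Nat.mul_le_mul_left _ hpairs)
  have hsum' : ∑ a ∈ W, (excess d M (insert a A) : ℝ) + E ≤ W.card * Φ := by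
    exact_mod_cast hsum
  have hMm' : (W.card : ℝ) * M ≤ Φ := by exact_mod_cast hMm
  have hE : (W.card : ℝ) * Φ * M / (2 * Fintype.card V) ≤ E := by
    rw [div_le_iff₀ (by positivity)]
    nlinarith [mul_le_mul_of_nonneg_right hMm' hΦ0]
  have : (W.card : ℝ) * (Φ * (1 - (M : ℝ) / (2 * Fintype.card V))) =
      W.card * Φ - (W.card : ℝ) * Φ * M / (2 * Fintype.card V) := by
    field_simp
  linarith

theorem exists_card_le_excess_le (d : V → V → ℕ∞) (M T : ℕ) :
    ∃ A : Finset V, A.card ≤ T ∧ (excess d M A : ℝ) ≤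
      (Fintype.card V : ℝ) ^ 2 * Real.exp (-((M : ℝ) / (2 * Fintype.card V))) ^ T := by
  induction T with
  | zero =>
    refine ⟨∅, le_rfl, ?_⟩
    have : excess d M ∅ ≤ Fintype.card V * Fintype.card V := by
      refine (Finset.sum_le_card_nsmul _ _ _ fun w _ => Finset.card_le_univ _).trans ?_
      exact Nat.mul_le_mul_right _ (Finset.card_le_univ _)
    rw [pow_zero, mul_one, sq]
    exact_mod_cast this
  | succ T ih =>
    obtain ⟨A, hA, hE⟩ := ih
    by_cases h : (overfull d M A).Nonempty
    · obtain ⟨a, ha⟩ := exists_excess_insert_le d M A h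
      refine ⟨insert a A, (Finset.card_insert_le _ _).trans (by omega), ha.trans ?_⟩
      rw [pow_succ (Real.exp _), ← mul_assoc]
      refine (mul_le_mul_of_nonneg_left ?_ (Nat.cast_nonneg _)).trans
        (mul_le_mul_of_nonneg_right hE (Real.exp_nonneg _))
      have := Real.add_one_le_exp (-((M : ℝ) / (2 * Fintype.card V)))
      linarith
    · refine ⟨A, by omega, ?_⟩
      rw [Finset.not_nonempty_iff_eq_empty] at h
      simp only [excess, h, Finset.sum_empty, Nat.cast_zero]
      positivity

/-- A small set of landmarks all of whose clusters have at most `M` elements. -/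
theorem exists_landmarks (d : V → V → ℕ∞) {M : ℕ} (hM : 0 < M) [Nonempty V] :
    ∃ A : Finset V, (A.card : ℝ) ≤
        4 * Fintype.card V * Real.log (Fintype.card V) / M + 1 ∧
      ∀ w, (cluster d A w).card ≤ M := by
  have hn : (1 : ℝ) ≤ Fintype.card V := by exact_mod_cast Fintype.card_pos
  have hM' : (0 : ℝ) < M := by exact_mod_cast hM
  have hlog : 0 ≤ Real.log (Fintype.card V) := Real.log_nonneg hn
  set x := 4 * Fintype.card V * Real.log (Fintype.card V) / M with hx
  have hx0 : 0 ≤ x := by positivity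
  obtain ⟨A, hA, hE⟩ := exists_card_le_excess_le d M (⌊x⌋₊ + 1)
  refine ⟨A, ?_, ?_⟩
  · have := Nat.floor_le hx0
    have h2 : (A.card : ℝ) ≤ ⌊x⌋₊ + 1 := by exact_mod_cast hA
    linarith
  · have hlt : (excess d M A : ℝ) < 1 := by
      refine hE.trans_lt ?_
      have h1 : (Fintype.card V : ℝ) ^ 2 = Real.exp (2 * Real.log (Fintype.card V)) := by
        rw [mul_comm, Real.exp_mul, Real.exp_log (by linarith)]
        norm_cast
      rw [h1, ← Real.exp_nat_mul, ← Real.exp_add, Real.exp_lt_one_iff]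
      have h2 : x < ⌊x⌋₊ + 1 := Nat.lt_floor_add_one x
      have h3 : x * (M / (2 * Fintype.card V)) = 2 * Real.log (Fintype.card V) := by
        rw [hx]; field_simp; ring
      have h4 : (0 : ℝ) < M / (2 * Fintype.card V) := by positivity
      have h5 := mul_lt_mul_of_pos_right h2 h4
      push_cast
      linarith
    have h0 : excess d M A = 0 := by
      have : excess d M A < 1 := by exact_mod_cast hlt
      omega
    intro w
    by_contra! hw
    have hmem : w ∈ overfull d M A := by simpa [overfull] using hw
    have := Finset.sum_eq_zero_iff.1 h0 w hmem
    omega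

end Landmarks

section Hashing

/-- Changing one summand of `a u + b v` separates distinct keys, so a fraction of at most `1 / m`
of all tables makes two given keys collide. -/
theorem card_collide_mul_le {U V : Type*} [Fintype U] [Fintype V] [DecidableEq U] [DecidableEq V]
    (m : ℕ) {x y : U × V} (hxy : x ≠ y) :
    m * ((Finset.univ : Finset (U ⊕ V → Fin m)).filter fun T =>
      (T (.inl x.1) : ℕ) + T (.inr x.2) = T (.inl y.1) + T (.inr y.2)).card ≤
      Fintype.card (U ⊕ V → Fin m) := by
  classical
  obtain ⟨i, hi⟩ : ∃ i : U ⊕ V, (i = .inl x.1 ∧ x.1 ≠ y.1) ∨ (i = .inr x.2 ∧ x.2 ≠ y.2) := by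
    by_cases h : x.1 = y.1
    · exact ⟨_, .inr ⟨rfl, fun h' => hxy (Prod.ext h h')⟩⟩
    · exact ⟨_, .inl ⟨rfl, h⟩⟩
  have hm : m = (Finset.univ : Finset (Fin m)).card := by simp
  refine (congrArg (· * _) hm).trans_le ?_
  rw [← Finset.card_product, ← Finset.card_univ (α := U ⊕ V → Fin m)]
  refine Finset.card_le_card_of_injOn (fun p => Function.update p.2 i p.1)
    (fun _ _ => Finset.mem_coe.2 (Finset.mem_univ _)) ?_
  rintro ⟨c, T⟩ hT ⟨c', T'⟩ hT' h
  simp only [Finset.coe_product, Set.mem_prod, Finset.mem_coe, Finset.mem_filter,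
    Finset.mem_univ, true_and] at hT hT'
  simp only at h
  have hc : c = c' := by simpa using congrFun h i
  have hne : ∀ j, j ≠ i → T j = T' j := fun j hj => by
    simpa [Function.update_of_ne hj] using congrFun h j
  have hTi : T i = T' i := by
    rcases hi with ⟨rfl, h1⟩ | ⟨rfl, h1⟩
    · have e1 := hne (.inl y.1) (by simpa using Ne.symm h1)
      have e2 := hne (.inr y.2) (by simp)
      have e3 := hne (.inr x.2) (by simp)
      rw [e1, e2, e3] at hT
      exact Fin.ext (by omega)
    · have e1 := hne (.inr y.2) (by simpa using Ne.symm h1)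
      have e2 := hne (.inl y.1) (by simp)
      have e3 := hne (.inl x.1) (by simp)
      rw [e1, e2, e3] at hT
      exact Fin.ext (by omega)
  refine Prod.ext hc (funext fun j => ?_)
  by_cases hj : j = i
  · rw [hj]; exact hTi
  · exact hne j hj

/-- Two tables whose sum makes few of the given pairs of keys collide. -/
theorem exists_tables_few_collisions {U V : Type*} [Fintype U] [Fintype V] [DecidableEq U]
    [DecidableEq V] {m : ℕ} (hm : 0 < m) (Q : Finset ((U × V) × (U × V)))
    (hQ : ∀ p ∈ Q, p.1 ≠ p.2) :
    ∃ (a : U → ℕ) (b : V → ℕ), (∀ u, a u < m) ∧ (∀ v, b v < m) ∧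
      m * (Q.filter fun p => a p.1.1 + b p.1.2 = a p.2.1 + b p.2.2).card ≤ Q.card := by
  classical
  have : NeZero m := ⟨hm.ne'⟩
  have hsum : ∑ T : U ⊕ V → Fin m, m * (Q.filter fun p =>
      (T (.inl p.1.1) : ℕ) + T (.inr p.1.2) = T (.inl p.2.1) + T (.inr p.2.2)).card ≤
      ∑ _T : U ⊕ V → Fin m, Q.card := by
    rw [← Finset.mul_sum]
    simp only [Finset.card_filter]
    rw [Finset.sum_comm, Finset.mul_sum, Finset.sum_const, smul_eq_mul, Finset.card_univ,
      mul_comm, ← smul_eq_mul]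
    refine Finset.sum_le_card_nsmul _ _ _ fun p hp => ?_
    have := card_collide_mul_le m (hQ p hp)
    rwa [Finset.card_filter] at this
  obtain ⟨T, -, hT⟩ := Finset.exists_le_of_sum_le Finset.univ_nonempty hsum
  exact ⟨fun u => T (.inl u), fun v => T (.inr v), fun u => (T _).2, fun v => (T _).2, hT⟩

/-- Buckets that are placed in the order of decreasing size find a free displacement. -/
theorem exists_displacement {K : Type*} [DecidableEq K] (S : Finset K) (g f : K → ℕ)
    (hinj : ∀ x ∈ S, ∀ y ∈ S, g x = g y → f x = f y → x = y) :
    ∃ δ : ℕ → ℕ, (∀ i, δ i ≤ ∑ j ∈ S.image g, (S.filter fun x => g x = j).card ^ 2) ∧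
      ∀ x ∈ S, ∀ y ∈ S, δ (g x) + f x = δ (g y) + f y → x = y := by
  set size : ℕ → ℕ := fun j => (S.filter fun x => g x = j).card with hsize
  set B := ∑ j ∈ S.image g, size j ^ 2 with hB
  suffices h : ∀ I : Finset ℕ, I ⊆ S.image g → ∃ δ : ℕ → ℕ, (∀ i, δ i ≤ B) ∧
      ∀ x ∈ S, ∀ y ∈ S, g x ∈ I → g y ∈ I → δ (g x) + f x = δ (g y) + f y → x = y by
    obtain ⟨δ, h1, h2⟩ := h _ subset_rfl
    exact ⟨δ, h1, fun x hx y hy => h2 x hx y hy (Finset.mem_image_of_mem g hx)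
      (Finset.mem_image_of_mem g hy)⟩
  refine fun I => Finset.induction_on_min_value size I
    (fun _ => ⟨fun _ => 0, by simp, by simp⟩) ?_
  · intro i s his hmin ih hsub
    obtain ⟨δ, hδB, hδ⟩ := ih ((Finset.subset_insert _ _).trans hsub)
    set placed := S.filter fun y => g y ∈ s with hplaced
    set bucket := S.filter fun x => g x = i with hbucket
    set bad := (bucket ×ˢ placed).image fun p => δ (g p.2) + f p.2 - f p.1 with hbad
    have hcard : bad.card ≤ B := by
      refine Finset.card_image_le.trans ?_
      rw [Finset.card_product]
      have hp : placed.card = ∑ j ∈ s, size j := by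
        rw [Finset.card_eq_sum_card_fiberwise (f := g) (t := s)
          (fun y hy => by simpa using (Finset.mem_filter.1 hy).2)]
        refine Finset.sum_congr rfl fun j hj => ?_
        rw [hsize]
        congr 1
        ext y
        simp only [hplaced, Finset.mem_filter]
        constructor
        · rintro ⟨⟨h1, -⟩, h3⟩; exact ⟨h1, h3⟩
        · rintro ⟨h1, h3⟩; exact ⟨⟨h1, h3 ▸ hj⟩, h3⟩
      rw [hp, Finset.mul_sum, hB]
      refine (Finset.sum_le_sum fun j hj => ?_).trans
        (Finset.sum_le_sum_of_subset ((Finset.subset_insert i s).trans hsub))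
      rw [sq]
      exact Nat.mul_le_mul_right _ (hmin j hj)
    obtain ⟨e, heB, hebad⟩ : ∃ e ∈ Finset.range (B + 1), e ∉ bad := by
      by_contra! hcon
      have := Finset.card_le_card (s := Finset.range (B + 1)) (t := bad) hcon
      rw [Finset.card_range] at this
      omega
    have key : ∀ x ∈ S, ∀ y ∈ S, g x = i → g y ∈ s → e + f x ≠ δ (g y) + f y := by
      intro x hx y hy hxi hys h
      refine hebad (Finset.mem_image.2 ⟨(x, y), ?_, ?_⟩)
      · simp [hbucket, hplaced, hx, hy, hxi, hys]
      · simp only; omega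
    refine ⟨Function.update δ i e, fun j => ?_, fun x hx y hy hxI hyI h => ?_⟩
    · by_cases hj : j = i
      · subst hj; simpa using Nat.lt_succ_iff.1 (Finset.mem_range.1 heB)
      · rw [Function.update_of_ne hj]; exact hδB j
    · have hns : ∀ z, g z ∈ s → g z ≠ i := fun z hz h' => his (h' ▸ hz)
      rcases Finset.mem_insert.1 hxI with hx1 | hx1 <;> rcases Finset.mem_insert.1 hyI with hy1 | hy1
      · rw [hx1, hy1] at h
        exact hinj x hx y hy (hx1.trans hy1.symm) (by omega)
      · rw [hx1, Function.update_self, Function.update_of_ne (hns y hy1)] at h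
        exact absurd h (key x hx y hy hx1 hy1)
      · rw [hy1, Function.update_self, Function.update_of_ne (hns x hx1)] at h
        exact absurd h.symm (key y hy x hx hy1 hx1)
      · rw [Function.update_of_ne (hns y hy1), Function.update_of_ne (hns x hx1)] at h
        exact hδ x hx y hy hx1 hy1 h

/-- A set of pairs has a perfect hash function of linear range, computed from four tables indexed by
the components and one table of displacements. -/
theorem exists_perfect_hash {U V : Type*} [Fintype U] [Fintype V] [DecidableEq U] [DecidableEq V]
    (S : Finset (U × V)) :
    ∃ (a c : U → ℕ) (b e : V → ℕ) (δ : ℕ → ℕ),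
      (∀ u, a u ≤ S.card) ∧ (∀ v, b v ≤ S.card) ∧ (∀ u, c u ≤ S.card) ∧ (∀ v, e v ≤ S.card) ∧
      (∀ i, δ i ≤ 2 * S.card) ∧
      ∀ x ∈ S, ∀ y ∈ S,
        δ (a x.1 + b x.2) + (c x.1 + e x.2) = δ (a y.1 + b y.2) + (c y.1 + e y.2) → x = y := by
  set N := S.card with hN
  obtain ⟨a, b, ha, hb, hab⟩ := exists_tables_few_collisions (Nat.succ_pos N) S.offDiag
    (fun p hp => (Finset.mem_offDiag.1 hp).2.2)
  set Q := S.offDiag.filter fun p => a p.1.1 + b p.1.2 = a p.2.1 + b p.2.2 with hQ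
  have hQcard : Q.card ≤ N := by
    rw [Finset.offDiag_card, ← hN] at hab
    by_contra! hcon
    have := Nat.mul_le_mul_left N.succ hcon
    have h2 : N * N ≤ N.succ * N.succ := Nat.mul_le_mul (Nat.le_succ _) (Nat.le_succ _)
    have h3 : N.succ * N.succ = N * N + 2 * N + 1 := by rw [Nat.succ_eq_add_one]; ring
    omega
  obtain ⟨c, e, hc, he, hce⟩ := exists_tables_few_collisions (Nat.succ_pos N) Q
    (fun p hp => (Finset.mem_offDiag.1 (Finset.mem_filter.1 hp).1).2.2)
  have hempty : Q.filter (fun p => c p.1.1 + e p.1.2 = c p.2.1 + e p.2.2) = ∅ := by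
    rw [← Finset.card_eq_zero]
    by_contra hcon
    have := Nat.mul_le_mul_left N.succ (Nat.one_le_iff_ne_zero.2 hcon)
    omega
  obtain ⟨δ, hδ, hδinj⟩ := exists_displacement S (fun x => a x.1 + b x.2)
    (fun x => c x.1 + e x.2) (by
      intro x hx y hy h1 h2
      by_contra hxy
      have : (x, y) ∈ Q.filter (fun p => c p.1.1 + e p.1.2 = c p.2.1 + e p.2.2) := by
        simp only [hQ, Finset.mem_filter, Finset.mem_offDiag]
        exact ⟨⟨⟨hx, hy, hxy⟩, h1⟩, h2⟩
      rw [hempty] at this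
      exact absurd this (Finset.notMem_empty _))
  refine ⟨a, c, b, e, δ, fun u => Nat.lt_succ_iff.1 (ha u), fun v => Nat.lt_succ_iff.1 (hb v),
    fun u => Nat.lt_succ_iff.1 (hc u), fun v => Nat.lt_succ_iff.1 (he v), fun i => ?_, hδinj⟩
  refine (hδ i).trans ?_
  have hsq : ∑ j ∈ S.image (fun x => a x.1 + b x.2),
      (S.filter fun x => a x.1 + b x.2 = j).card ^ 2 =
      ((S ×ˢ S).filter fun p => a p.1.1 + b p.1.2 = a p.2.1 + b p.2.2).card := by
    rw [Finset.card_eq_sum_card_fiberwise (f := fun p : (U × V) × (U × V) => a p.1.1 + b p.1.2)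
      (t := S.image (fun x => a x.1 + b x.2))]
    · refine Finset.sum_congr rfl fun j _ => ?_
      rw [sq, ← Finset.card_product]
      congr 1
      ext p
      simp only [Finset.mem_product, Finset.mem_filter]
      grind
    · intro p hp
      simp only [Finset.mem_coe, Finset.mem_filter, Finset.mem_product] at hp
      exact Finset.mem_coe.2 (Finset.mem_image_of_mem (fun x : U × V => a x.1 + b x.2) hp.1.1)
  rw [hsq, ← Finset.diag_union_offDiag, Finset.filter_union]
  refine (Finset.card_union_le _ _).trans ?_
  have := Finset.card_filter_le S.diag fun p => a p.1.1 + b p.1.2 = a p.2.1 + b p.2.2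
  rw [Finset.diag_card] at this
  have hq : (S.offDiag.filter fun p => a p.1.1 + b p.1.2 = a p.2.1 + b p.2.2).card = Q.card := rfl
  omega

end Hashing

section Graph

variable {V : Type*} {G : SimpleGraph V}

/-- A vertex at a prescribed position on a shortest path. -/
theorem SimpleGraph.exists_edist_le_of_edist_eq {u v : V} {m i j : ℕ} (h : G.edist u v = m)
    (hij : m ≤ i + j) : ∃ x, G.edist u x ≤ i ∧ G.edist x v ≤ j := by
  have hr : G.Reachable u v := by
    rw [← SimpleGraph.edist_ne_top_iff_reachable, h]
    exact ENat.natCast_ne_top _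
  obtain ⟨p, hp⟩ := hr.exists_walk_length_eq_edist
  have hpm : p.length = m := by exact_mod_cast hp.trans h
  refine ⟨p.getVert i, (SimpleGraph.edist_le (p.take i)).trans ?_,
    (SimpleGraph.edist_le (p.drop i)).trans ?_⟩
  · rw [SimpleGraph.Walk.take_length]
    exact_mod_cast min_le_left _ _
  · rw [SimpleGraph.Walk.drop_length]
    exact_mod_cast (by omega : p.length - i ≤ j)

theorem SimpleGraph.edist_lt_card [Fintype V] {u v : V} (h : G.edist u v ≠ ⊤) :
    G.edist u v < Fintype.card V := by
  classical
  obtain ⟨p, hp⟩ := (SimpleGraph.edist_ne_top_iff_reachable.1 h).exists_walk_length_eq_edist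
  refine (SimpleGraph.edist_le p.bypass).trans_lt ?_
  exact_mod_cast p.bypass_isPath.length_lt

variable [Fintype V]

/-- The vertices at distance at most `k` from `x`. -/
noncomputable def SimpleGraph.closedBallFinset (G : SimpleGraph V) (k : ℕ) (x : V) : Finset V :=
  open Classical in {y | G.edist x y ≤ k}

theorem SimpleGraph.mem_closedBallFinset {k : ℕ} {x y : V} :
    y ∈ G.closedBallFinset k x ↔ G.edist x y ≤ k := by
  simp [SimpleGraph.closedBallFinset]

theorem SimpleGraph.closedBallFinset_zero [DecidableEq V] (x : V) : G.closedBallFinset 0 x = {x} := by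
  ext y
  rw [SimpleGraph.mem_closedBallFinset, Nat.cast_zero, nonpos_iff_eq_zero,
    SimpleGraph.edist_eq_zero_iff, Finset.mem_singleton, eq_comm]

theorem SimpleGraph.closedBallFinset_succ_subset [DecidableEq V] [DecidableRel G.Adj] (k : ℕ) (x : V) :
    G.closedBallFinset (k + 1) x ⊆
      insert x ((G.closedBallFinset k x).biUnion fun z => G.neighborFinset z) := by
  intro y hy
  rw [SimpleGraph.mem_closedBallFinset] at hy
  rw [Finset.mem_insert, Finset.mem_biUnion]
  by_cases hyx : y = x
  · exact .inl hyx
  obtain ⟨m, hm⟩ := ENat.ne_top_iff_exists.1 (ne_top_of_le_ne_top (ENat.natCast_ne_top _) hy)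
  have hmk : m ≤ k + 1 := by rw [← hm] at hy; exact_mod_cast hy
  obtain ⟨z, hz1, hz2⟩ := SimpleGraph.exists_edist_le_of_edist_eq (i := k) (j := 1) hm.symm hmk
  by_cases hzy : z = y
  · subst hzy
    obtain ⟨m', hm'⟩ := ENat.ne_top_iff_exists.1 (ne_top_of_le_ne_top (ENat.natCast_ne_top _) hz1)
    have h0 : m' ≠ 0 := by
      rintro rfl
      exact hyx (SimpleGraph.edist_eq_zero_iff.1 hm'.symm).symm
    have hmk' : m' ≤ k := by rw [← hm'] at hz1; exact_mod_cast hz1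
    obtain ⟨p, hp⟩ := (SimpleGraph.edist_ne_top_iff_reachable.1
      (ne_top_of_le_ne_top (ENat.natCast_ne_top _) hz1)).exists_walk_length_eq_edist
    have hpm : p.length = m' := by exact_mod_cast hp.trans hm'.symm
    refine .inr ⟨p.penultimate, ?_, ?_⟩
    · rw [SimpleGraph.mem_closedBallFinset]
      refine (SimpleGraph.edist_le p.dropLast).trans ?_
      rw [SimpleGraph.Walk.length_dropLast]
      exact_mod_cast (by omega : p.length - 1 ≤ k)
    · rw [SimpleGraph.mem_neighborFinset]
      refine p.adj_penultimate fun hnil => ?_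
      rw [← SimpleGraph.Walk.length_eq_zero_iff] at hnil
      omega
  · refine .inr ⟨z, SimpleGraph.mem_closedBallFinset.2 hz1, ?_⟩
    rw [SimpleGraph.mem_neighborFinset]
    have : G.edist z y = 1 := le_antisymm hz2 (by
      rw [Order.one_le_iff_ne_zero, Ne, SimpleGraph.edist_eq_zero_iff]; exact hzy)
    exact SimpleGraph.edist_eq_one_iff_adj.1 this

theorem SimpleGraph.card_closedBallFinset_le [DecidableRel G.Adj] (k : ℕ) (x : V) :
    (G.closedBallFinset k x).card ≤ 2 * max 1 (G.maxDegree ^ k) := by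
  classical
  rcases le_or_gt G.maxDegree 1 with hΔ | hΔ
  · have hsub : G.closedBallFinset k x ⊆ insert x (G.neighborFinset x) := by
      induction k with
      | zero => rw [SimpleGraph.closedBallFinset_zero]; simp
      | succ k ih =>
        refine (SimpleGraph.closedBallFinset_succ_subset k x).trans fun y hy => ?_
        rw [Finset.mem_insert, Finset.mem_biUnion] at hy
        rcases hy with rfl | ⟨z, hz, hy⟩
        · simp
        rcases Finset.mem_insert.1 (ih hz) with rfl | hxz
        · exact Finset.mem_insert_of_mem hy
        · rw [SimpleGraph.mem_neighborFinset] at hy hxz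
          have hcard : (G.neighborFinset z).card ≤ 1 := by
            rw [SimpleGraph.card_neighborFinset_eq_degree]
            exact (G.degree_le_maxDegree z).trans hΔ
          have := Finset.card_le_one.1 hcard y (by simpa using hy) x (by simpa using hxz.symm)
          simp [this]
    have h1 := (Finset.card_le_card hsub).trans (Finset.card_insert_le _ _)
    rw [SimpleGraph.card_neighborFinset_eq_degree] at h1
    have h2 := G.degree_le_maxDegree x
    have h3 := le_max_left 1 (G.maxDegree ^ k)
    omega
  · have h : (G.closedBallFinset k x).card + 1 ≤ 2 * G.maxDegree ^ k := by
      induction k with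
      | zero => rw [SimpleGraph.closedBallFinset_zero]; simp
      | succ k ih =>
        have h1 := (Finset.card_le_card (SimpleGraph.closedBallFinset_succ_subset (G := G) k x)).trans
          (Finset.card_insert_le _ _)
        have h2 := Finset.card_biUnion_le_card_mul (G.closedBallFinset k x)
          (fun z => G.neighborFinset z) G.maxDegree fun z _ => by
            rw [SimpleGraph.card_neighborFinset_eq_degree]; exact G.degree_le_maxDegree z
        have h3 := Nat.mul_le_mul_right G.maxDegree ih
        rw [pow_succ, ← mul_assoc]
        rw [add_mul, one_mul] at h3
        omega
    have h3 := le_max_right 1 (G.maxDegree ^ k)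
    omega

variable [DecidableEq V]

/-- The pairs of vertices that lie in the clusters of two vertices at distance at most `k`. -/
noncomputable def nearPairs (G : SimpleGraph V) (A : Finset V) (k : ℕ) : Finset (V × V) :=
  Finset.univ.biUnion fun x => (G.closedBallFinset k x).biUnion fun y =>
    cluster G.edist A x ×ˢ cluster G.edist A y

theorem mem_nearPairs {A : Finset V} {k : ℕ} {u v : V} :
    (u, v) ∈ nearPairs G A k ↔ ∃ x y, G.edist x y ≤ k ∧
      (∀ a ∈ A, G.edist x u < G.edist a u) ∧ ∀ a ∈ A, G.edist y v < G.edist a v := by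
  simp [nearPairs, cluster, SimpleGraph.mem_closedBallFinset]

theorem card_nearPairs_le [DecidableRel G.Adj] {A : Finset V} {k M : ℕ}
    (hM : ∀ x, (cluster G.edist A x).card ≤ M) :
    (nearPairs G A k).card ≤
      Fintype.card V * ((2 * max 1 (G.maxDegree ^ k)) * (M * M)) := by
  refine Finset.card_biUnion_le_card_mul _ _ _ fun x _ => ?_
  refine (Finset.card_biUnion_le_card_mul _ _ (M * M) fun y _ => ?_).trans
    (Nat.mul_le_mul_right _ (SimpleGraph.card_closedBallFinset_le k x))
  rw [Finset.card_product]
  exact Nat.mul_le_mul (hM x) (hM y)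

/-- A pair at finite distance that is not near has a landmark close to one of its members. -/
theorem exists_landmark_of_notMem_nearPairs {A : Finset V} {k m : ℕ} {u v : V}
    (h : (u, v) ∉ nearPairs G A k) (hm : G.edist u v = m) :
    ∃ a ∈ A, ∃ r : ℕ, (r = 0 ∨ 2 * r + k ≤ m + 1) ∧
      (G.edist a u = r ∨ G.edist a v = r) := by
  by_contra! hcon
  obtain ⟨x, hux, hxv⟩ := SimpleGraph.exists_edist_le_of_edist_eq (i := (m - k + 1) / 2)
    (j := m - (m - k + 1) / 2) hm (by omega)
  obtain ⟨m', hm'⟩ := ENat.ne_top_iff_exists.1 (ne_top_of_le_ne_top (ENat.natCast_ne_top _) hxv)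
  have hmm : m' ≤ m - (m - k + 1) / 2 := by rw [← hm'] at hxv; exact_mod_cast hxv
  obtain ⟨y, hxy, hyv⟩ := SimpleGraph.exists_edist_le_of_edist_eq (i := k)
    (j := (m - k) / 2) hm'.symm (by omega)
  refine h (mem_nearPairs.2 ⟨x, y, hxy, fun a ha => ?_, fun a ha => ?_⟩)
  · rw [SimpleGraph.edist_comm]
    refine hux.trans_lt ?_
    by_contra! hle
    obtain ⟨r, hr⟩ := ENat.ne_top_iff_exists.1 (ne_top_of_le_ne_top (ENat.natCast_ne_top _) hle)
    have hrle : r ≤ (m - k + 1) / 2 := by rw [← hr] at hle; exact_mod_cast hle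
    by_cases hc : r = 0 ∨ 2 * r + k ≤ m + 1
    · exact (hcon a ha r hc).1 hr.symm
    · omega
  · refine hyv.trans_lt ?_
    by_contra! hle
    obtain ⟨r, hr⟩ := ENat.ne_top_iff_exists.1 (ne_top_of_le_ne_top (ENat.natCast_ne_top _) hle)
    have hrle : r ≤ (m - k) / 2 := by rw [← hr] at hle; exact_mod_cast hle
    by_cases hc : r = 0 ∨ 2 * r + k ≤ m + 1
    · exact (hcon a ha r hc).2 hr.symm
    · omega

end Graph

namespace WordRAM

section Query

/-- Write to register `d` the entry of section `s` whose index is in register `x`. Section `s`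
occupies the addresses `16 * i + s`; register `2` holds `16` and register `3` is overwritten. -/
def readSection (d x s : ℕ) : Program :=
  [.op .mul d x 2, .const 3 s, .op .add d d 3, .load d d]

/-- Look the pair up in the hash table (sections `0` to `7`); if it is absent, return the shorter of
the two routes through the nearest landmarks (sections `8` to `10`). -/
def distanceProgram : Program :=
  [.const 2 16] ++ readSection 4 0 0 ++ readSection 5 1 1 ++ [.op .add 4 4 5] ++
  readSection 6 4 4 ++ readSection 7 0 2 ++ readSection 8 1 3 ++
  [.op .add 7 7 8, .op .add 6 6 7] ++
  readSection 9 6 5 ++ [.jumpEq 9 0 30, .jumpEq 0 0 41] ++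
  readSection 10 6 6 ++ [.jumpEq 10 1 36, .jumpEq 0 0 41] ++
  readSection 11 6 7 ++ [.halt 11] ++
  [.const 12 0, .const 13 1, .op .sub 12 12 13] ++
  readSection 14 0 8 ++ [.jumpEq 14 12 77] ++
  readSection 15 0 9 ++ [.op .add 15 15 1] ++ readSection 15 15 10 ++ [.jumpEq 15 12 77] ++
  readSection 16 1 8 ++ readSection 17 1 9 ++ [.op .add 17 17 0] ++ readSection 17 17 10 ++
  [.op .add 14 14 15, .op .add 16 16 17, .jumpLt 14 16 76, .halt 16, .halt 14, .halt 12]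

/-- The memory of length `16 * l` whose section `s` has the entries `F s 0, …, F s (l - 1)`. -/
def sectionMemory (w l : ℕ) (F : ℕ → ℕ → ℕ) : List (BitVec w) :=
  (List.range (16 * l)).map fun q => BitVec.ofNat w (F (q % 16) (q / 16))

theorem length_sectionMemory (w l : ℕ) (F : ℕ → ℕ → ℕ) :
    (sectionMemory w l F).length = 16 * l := by
  simp [sectionMemory]

theorem getD_sectionMemory {w l : ℕ} (F : ℕ → ℕ → ℕ) {i s : ℕ} (hs : s < 16) (hi : i < l) :
    (sectionMemory w l F).getD (16 * i + s) 0 = BitVec.ofNat w (F s i) := by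
  have h : 16 * i + s < 16 * l := by omega
  have h1 : (16 * i + s) % 16 = s := by omega
  have h2 : (16 * i + s) / 16 = i := by omega
  simp [sectionMemory, List.getD_eq_getElem?_getD, h, h1, h2]

variable {w : ℕ} {P : Program} {D : List (BitVec w)} {t pc : ℕ} {R : ℕ → BitVec w}

theorem eval_const {d m : ℕ} (h : P[pc]? = some (.const d m)) :
    P.eval D (t + 1) pc R = P.eval D t (pc + 1) (Function.update R d (BitVec.ofNat w m)) := by
  rw [Program.eval, h]

theorem eval_op {o : BinOp} {d i j : ℕ} (h : P[pc]? = some (.op o d i j)) :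
    P.eval D (t + 1) pc R =
      P.eval D t (pc + 1) (Function.update R d (o.apply (R i) (R j))) := by
  rw [Program.eval, h]

theorem eval_load {d i : ℕ} (h : P[pc]? = some (.load d i)) :
    P.eval D (t + 1) pc R =
      P.eval D t (pc + 1) (Function.update R d (D.getD (R i).toNat 0)) := by
  rw [Program.eval, h]

theorem eval_jumpEq {i j l : ℕ} (h : P[pc]? = some (.jumpEq i j l)) :
    P.eval D (t + 1) pc R = P.eval D t (if R i = R j then l else pc + 1) R := by
  rw [Program.eval, h]

theorem eval_jumpLt {i j l : ℕ} (h : P[pc]? = some (.jumpLt i j l)) :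
    P.eval D (t + 1) pc R =
      P.eval D t (if (R i).toNat < (R j).toNat then l else pc + 1) R := by
  rw [Program.eval, h]

theorem eval_halt {i : ℕ} (h : P[pc]? = some (.halt i)) :
    P.eval D (t + 1) pc R = some (R i) := by
  rw [Program.eval, h]

theorem eval_readSection {l : ℕ} {F : ℕ → ℕ → ℕ} (hl : 16 * l ≤ 2 ^ w) {d x s i : ℕ}
    (h0 : P[pc]? = some (.op .mul d x 2)) (h1 : P[pc + 1]? = some (.const 3 s))
    (h2 : P[pc + 2]? = some (.op .add d d 3)) (h3 : P[pc + 3]? = some (.load d d))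
    (hd : d ≠ 3) (hR2 : R 2 = BitVec.ofNat w 16) (hRx : R x = BitVec.ofNat w i)
    (hs : s < 16) (hi : i < l) :
    P.eval (sectionMemory w l F) (t + 4) pc R = P.eval (sectionMemory w l F) t (pc + 4)
      (Function.update (Function.update R 3 (BitVec.ofNat w s)) d (BitVec.ofNat w (F s i))) := by
  rw [eval_op h0, eval_const h1, eval_op h2, eval_load h3]
  have haddr : (BitVec.ofNat w i * BitVec.ofNat w 16 + BitVec.ofNat w s).toNat = 16 * i + s := by
    rw [← BitVec.ofNat_mul, ← BitVec.ofNat_add, BitVec.toNat_ofNat,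
      Nat.mod_eq_of_lt (by omega)]
    omega
  simp only [BinOp.apply, hR2, hRx, Function.update_self, Function.update_of_ne hd, Function.update_idem,
    haddr]
  rw [getD_sectionMemory F hs hi]
  congr 1
  funext j
  simp only [Function.update]
  grind

theorem ofNat_inj_of_lt {x y : ℕ} (hx : x < 2 ^ w) (hy : y < 2 ^ w) :
    BitVec.ofNat w x = BitVec.ofNat w y ↔ x = y := by
  refine ⟨fun h => ?_, fun h => h ▸ rfl⟩
  have := congrArg BitVec.toNat h
  rwa [BitVec.toNat_ofNat, BitVec.toNat_ofNat, Nat.mod_eq_of_lt hx, Nat.mod_eq_of_lt hy] at this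

/-- The prefix of the program that computes the hash address and loads the first key. -/
theorem eval_hashAddress {w l : ℕ} {F : ℕ → ℕ → ℕ} (hl : 16 * l ≤ 2 ^ w) {u v q : ℕ} (hu : u < l)
    (hv : v < l) (hg : F 0 u + F 1 v < l) (hq : q < l)
    (hqF : F 4 (F 0 u + F 1 v) + (F 2 u + F 3 v) = q) {t : ℕ} {res : Option (BitVec w)}
    (h : ∀ R : ℕ → BitVec w, R 0 = BitVec.ofNat w u → R 1 = BitVec.ofNat w v →
      R 2 = BitVec.ofNat w 16 → R 6 = BitVec.ofNat w q → R 9 = BitVec.ofNat w (F 5 q) →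
      distanceProgram.eval (sectionMemory w l F) t 28 R = res) :
    distanceProgram.query (sectionMemory w l F) (t + 28) u v = res := by
  subst hqF
  rw [Program.query, eval_const (d := 2) (m := 16) rfl,
    eval_readSection hl (d := 4) (x := 0) (s := 0) (i := u) rfl rfl rfl rfl (by decide)
      (by simp [Function.update]) (by simp [Function.update]) (by decide) hu,
    eval_readSection hl (d := 5) (x := 1) (s := 1) (i := v) rfl rfl rfl rfl (by decide)
      (by simp [Function.update]) (by simp [Function.update]) (by decide) hv,
    eval_op (o := .add) (d := 4) (i := 4) (j := 5) rfl,
    eval_readSection hl (d := 6) (x := 4) (s := 4) (i := F 0 u + F 1 v) rfl rfl rfl rfl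
      (by decide) (by simp [Function.update])
      (by simp [Function.update, BinOp.apply, BitVec.ofNat_add]) (by decide) hg,
    eval_readSection hl (d := 7) (x := 0) (s := 2) (i := u) rfl rfl rfl rfl (by decide)
      (by simp [Function.update]) (by simp [Function.update]) (by decide) hu,
    eval_readSection hl (d := 8) (x := 1) (s := 3) (i := v) rfl rfl rfl rfl (by decide)
      (by simp [Function.update]) (by simp [Function.update]) (by decide) hv,
    eval_op (o := .add) (d := 7) (i := 7) (j := 8) rfl,
    eval_op (o := .add) (d := 6) (i := 6) (j := 7) rfl,
    eval_readSection hl (d := 9) (x := 6) (s := 5)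
      (i := F 4 (F 0 u + F 1 v) + (F 2 u + F 3 v)) rfl rfl rfl rfl (by decide)
      (by simp [Function.update])
      (by simp [Function.update, BinOp.apply, BitVec.ofNat_add]) (by decide) hq]
  exact h _ (by simp [Function.update]) (by simp [Function.update]) (by simp [Function.update])
    (by simp [Function.update, BinOp.apply, BitVec.ofNat_add]) (by simp [Function.update])

/-- A pair found in the hash table is answered by the stored value. -/
theorem query_of_mem_table {w l : ℕ} {F : ℕ → ℕ → ℕ} (hl : 16 * l ≤ 2 ^ w) {u v q : ℕ} (hu : u < l)
    (hv : v < l) (hg : F 0 u + F 1 v < l) (hq : q < l)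
    (hqF : F 4 (F 0 u + F 1 v) + (F 2 u + F 3 v) = q) (h5 : F 5 q = u) (h6 : F 6 q = v) :
    distanceProgram.query (sectionMemory w l F) 80 u v = some (BitVec.ofNat w (F 7 q)) := by
  refine eval_hashAddress (t := 52) hl hu hv hg hq hqF fun R h0 h1 h2 hR6 h9 => ?_
  rw [eval_jumpEq (i := 9) (j := 0) (l := 30) rfl, if_pos (by rw [h9, h0, h5]),
    eval_readSection hl (d := 10) (x := 6) (s := 6) (i := q) rfl rfl rfl rfl (by decide) h2 hR6
      (by decide) hq,
    eval_jumpEq (i := 10) (j := 1) (l := 36) rfl, if_pos (by simp [Function.update, h1, h6]),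
    eval_readSection hl (d := 11) (x := 6) (s := 7) (i := q) rfl rfl rfl rfl (by decide)
      (by simp [Function.update, h2]) (by simp [Function.update, hR6]) (by decide) hq,
    eval_halt (i := 11) rfl]
  simp [Function.update]

theorem ofNat_sub_one_eq_allOnes : BitVec.ofNat w 0 - BitVec.ofNat w 1 = BitVec.allOnes w := by
  simp [← BitVec.neg_one_eq_allOnes]

theorem ofNat_eq_allOnes_iff {x : ℕ} (hx : x < 2 ^ w) :
    BitVec.ofNat w x = BitVec.allOnes w ↔ x = 2 ^ w - 1 := by
  have : BitVec.allOnes w = BitVec.ofNat w (2 ^ w - 1) := by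
    apply BitVec.eq_of_toNat_eq
    rw [BitVec.toNat_allOnes, BitVec.toNat_ofNat, Nat.mod_eq_of_lt (by omega)]
  rw [this, ofNat_inj_of_lt hx (by omega)]

/-- The suffix of the program that compares the two routes through landmarks. -/
theorem eval_landmarks {w l : ℕ} {F : ℕ → ℕ → ℕ} (hl : 16 * l ≤ 2 ^ w) {u v : ℕ} (hu : u < l)
    (hv : v < l) (huv : F 9 u + v < l) (hvu : F 9 v + u < l) (hru : F 8 u < 2 ^ w)
    (hxw : F 10 (F 9 u + v) < 2 ^ w)
    (hsum : F 8 u ≠ 2 ^ w - 1 → F 10 (F 9 u + v) ≠ 2 ^ w - 1 →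
      F 8 u + F 10 (F 9 u + v) < 2 ^ w ∧ F 8 v + F 10 (F 9 v + u) < 2 ^ w)
    (t : ℕ) {R : ℕ → BitVec w} (h0 : R 0 = BitVec.ofNat w u) (h1 : R 1 = BitVec.ofNat w v)
    (h2 : R 2 = BitVec.ofNat w 16) :
    distanceProgram.eval (sectionMemory w l F) (t + 35) 41 R =
      some (if F 8 u = 2 ^ w - 1 ∨ F 10 (F 9 u + v) = 2 ^ w - 1 then BitVec.allOnes w
        else BitVec.ofNat w (min (F 8 u + F 10 (F 9 u + v)) (F 8 v + F 10 (F 9 v + u)))) := by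
  rw [eval_const (d := 12) (m := 0) rfl, eval_const (d := 13) (m := 1) rfl,
    eval_op (o := .sub) (d := 12) (i := 12) (j := 13) rfl,
    eval_readSection hl (d := 14) (x := 0) (s := 8) (i := u) rfl rfl rfl rfl (by decide)
      (by simp [Function.update, h2]) (by simp [Function.update, h0]) (by decide) hu,
    eval_jumpEq (i := 14) (j := 12) (l := 77) rfl]
  by_cases hA : F 8 u = 2 ^ w - 1
  · have hA' := (ofNat_eq_allOnes_iff hru).2 hA
    rw [if_pos (by simpa [Function.update, BinOp.apply, ← ofNat_sub_one_eq_allOnes] using hA'),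
      eval_halt (i := 12) rfl, if_pos (Or.inl hA), ← ofNat_sub_one_eq_allOnes]
    simp [Function.update, BinOp.apply]
  have hA' := mt (ofNat_eq_allOnes_iff hru).1 hA
  rw [if_neg (by simpa [Function.update, BinOp.apply, ← ofNat_sub_one_eq_allOnes] using hA'),
    eval_readSection hl (d := 15) (x := 0) (s := 9) (i := u) rfl rfl rfl rfl (by decide)
      (by simp [Function.update, h2]) (by simp [Function.update, h0]) (by decide) hu,
    eval_op (o := .add) (d := 15) (i := 15) (j := 1) rfl,
    eval_readSection hl (d := 15) (x := 15) (s := 10) (i := F 9 u + v) rfl rfl rfl rfl (by decide)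
      (by simp [Function.update, h2])
      (by simp [Function.update, BinOp.apply, BitVec.ofNat_add, h1]) (by decide) huv,
    eval_jumpEq (i := 15) (j := 12) (l := 77) rfl]
  by_cases hB : F 10 (F 9 u + v) = 2 ^ w - 1
  · have hB' := (ofNat_eq_allOnes_iff hxw).2 hB
    rw [if_pos (by simpa [Function.update, BinOp.apply, ← ofNat_sub_one_eq_allOnes] using hB'),
      eval_halt (i := 12) rfl, if_pos (Or.inr hB), ← ofNat_sub_one_eq_allOnes]
    simp [Function.update, BinOp.apply]
  have hB' := mt (ofNat_eq_allOnes_iff hxw).1 hB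
  obtain ⟨hs1, hs2⟩ := hsum hA hB
  rw [if_neg (by simpa [Function.update, BinOp.apply, ← ofNat_sub_one_eq_allOnes] using hB'),
    if_neg (not_or.2 ⟨hA, hB⟩),
    eval_readSection hl (d := 16) (x := 1) (s := 8) (i := v) rfl rfl rfl rfl (by decide)
      (by simp [Function.update, h2]) (by simp [Function.update, h1]) (by decide) hv,
    eval_readSection hl (d := 17) (x := 1) (s := 9) (i := v) rfl rfl rfl rfl (by decide)
      (by simp [Function.update, h2]) (by simp [Function.update, h1]) (by decide) hv,
    eval_op (o := .add) (d := 17) (i := 17) (j := 0) rfl,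
    eval_readSection hl (d := 17) (x := 17) (s := 10) (i := F 9 v + u) rfl rfl rfl rfl (by decide)
      (by simp [Function.update, h2])
      (by simp [Function.update, BinOp.apply, BitVec.ofNat_add, h0]) (by decide) hvu,
    eval_op (o := .add) (d := 14) (i := 14) (j := 15) rfl,
    eval_op (o := .add) (d := 16) (i := 16) (j := 17) rfl,
    eval_jumpLt (i := 14) (j := 16) (l := 76) rfl]
  set e₁ := F 8 u + F 10 (F 9 u + v) with he₁
  set e₂ := F 8 v + F 10 (F 9 v + u) with he₂
  by_cases hlt : e₁ < e₂
  · rw [if_pos, eval_halt (i := 14) rfl, min_eq_left hlt.le]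
    · simp [Function.update, BinOp.apply, he₁, BitVec.ofNat_add]
    · simpa [Function.update, BinOp.apply, ← BitVec.ofNat_add, Nat.mod_eq_of_lt hs1,
        Nat.mod_eq_of_lt hs2, -BitVec.toNat_add, ← he₁, ← he₂] using hlt
  · rw [if_neg, eval_halt (i := 16) rfl, min_eq_right (not_lt.1 hlt)]
    · simp [Function.update, BinOp.apply, he₂, BitVec.ofNat_add]
    · simpa [Function.update, BinOp.apply, ← BitVec.ofNat_add, Nat.mod_eq_of_lt hs1,
        Nat.mod_eq_of_lt hs2, -BitVec.toNat_add, ← he₁, ← he₂] using hlt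

/-- A pair that is absent from the hash table is answered from the landmark sections. -/
theorem query_of_notMem_table {w l : ℕ} {F : ℕ → ℕ → ℕ} (hl : 16 * l ≤ 2 ^ w) {u v q : ℕ}
    (hu : u < l) (hv : v < l) (hg : F 0 u + F 1 v < l) (hq : q < l)
    (hqF : F 4 (F 0 u + F 1 v) + (F 2 u + F 3 v) = q) (h5w : F 5 q < 2 ^ w) (h6w : F 6 q < 2 ^ w)
    (h56 : ¬ (F 5 q = u ∧ F 6 q = v))
    (huv : F 9 u + v < l) (hvu : F 9 v + u < l) (hru : F 8 u < 2 ^ w)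
    (hxw : F 10 (F 9 u + v) < 2 ^ w)
    (hsum : F 8 u ≠ 2 ^ w - 1 → F 10 (F 9 u + v) ≠ 2 ^ w - 1 →
      F 8 u + F 10 (F 9 u + v) < 2 ^ w ∧ F 8 v + F 10 (F 9 v + u) < 2 ^ w) :
    distanceProgram.query (sectionMemory w l F) 80 u v =
      some (if F 8 u = 2 ^ w - 1 ∨ F 10 (F 9 u + v) = 2 ^ w - 1 then BitVec.allOnes w
        else BitVec.ofNat w (min (F 8 u + F 10 (F 9 u + v)) (F 8 v + F 10 (F 9 v + u)))) := by
  refine eval_hashAddress (t := 52) hl hu hv hg hq hqF fun R h0 h1 h2 hR6 h9 => ?_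
  rw [eval_jumpEq (i := 9) (j := 0) (l := 30) rfl]
  by_cases h5 : F 5 q = u
  · have h6 : F 6 q ≠ v := fun h => h56 ⟨h5, h⟩
    have h6' := mt (ofNat_inj_of_lt h6w (by omega : v < 2 ^ w)).1 h6
    rw [if_pos (by rw [h9, h0, h5]),
      eval_readSection hl (d := 10) (x := 6) (s := 6) (i := q) rfl rfl rfl rfl (by decide) h2 hR6
        (by decide) hq,
      eval_jumpEq (i := 10) (j := 1) (l := 36) rfl,
      if_neg (by simpa [Function.update, h1] using h6'),
      eval_jumpEq (i := 0) (j := 0) (l := 41) rfl, if_pos rfl]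
    exact eval_landmarks hl hu hv huv hvu hru hxw hsum 10 (by simp [Function.update, h0])
      (by simp [Function.update, h1]) (by simp [Function.update, h2])
  · have h5' := mt (ofNat_inj_of_lt h5w (by omega : u < 2 ^ w)).1 h5
    rw [if_neg (by rwa [h9, h0]), eval_jumpEq (i := 0) (j := 0) (l := 41) rfl, if_pos rfl]
    exact eval_landmarks hl hu hv huv hvu hru hxw hsum 15 h0 h1 h2

end Query

end WordRAM

namespace WordRAM

section Oracle

/-- The `w`-bit word, as a number, that represents a distance. -/
noncomputable def encodeDistance (w : ℕ) (d : ℕ∞) : ℕ :=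
  if d = ⊤ then 2 ^ w - 1 else d.toNat

theorem encodeDistance_top (w : ℕ) : encodeDistance w ⊤ = 2 ^ w - 1 := if_pos rfl

theorem encodeDistance_natCast (w m : ℕ) : encodeDistance w (m : ℕ∞) = m := by
  simp [encodeDistance]

theorem toDistance_ofNat {w m : ℕ} (hm : m < 2 ^ w - 1) :
    toDistance (BitVec.ofNat w m) = m := by
  rw [toDistance, if_neg, BitVec.toNat_ofNat, Nat.mod_eq_of_lt (by omega)]
  rw [ofNat_eq_allOnes_iff (by omega)]
  omega

theorem toDistance_allOnes {w : ℕ} : toDistance (BitVec.allOnes w) = ⊤ := if_pos rfl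

theorem toDistance_encodeDistance {w : ℕ} {d : ℕ∞} (h : d ≠ ⊤ → d < (2 ^ w - 1 : ℕ)) :
    toDistance (BitVec.ofNat w (encodeDistance w d)) = d := by
  by_cases hd : d = ⊤
  · have h2 : 0 < 2 ^ w := by positivity
    rw [hd, encodeDistance_top, (ofNat_eq_allOnes_iff (by omega)).2 rfl, toDistance_allOnes]
  · obtain ⟨m, rfl⟩ := ENat.ne_top_iff_exists.1 hd
    rw [encodeDistance_natCast, toDistance_ofNat]
    exact_mod_cast h hd

theorem hasStretch_self (α β : ℝ) (d : ℕ∞) : HasStretch α β d d :=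
  ⟨le_rfl, fun m hm => ⟨m, hm, le_max_left _ _⟩⟩

/-- Arrays that store the keys of a hash table and a value for each key. -/
theorem exists_hash_arrays {n : ℕ} (S : Finset (Fin n × Fin n)) (addr : Fin n × Fin n → ℕ)
    (val : Fin n × Fin n → ℕ) (hinj : ∀ x ∈ S, ∀ y ∈ S, addr x = addr y → x = y) :
    ∃ k₁ k₂ value : ℕ → ℕ,
      (∀ x ∈ S, k₁ (addr x) = x.1 ∧ k₂ (addr x) = x.2 ∧ value (addr x) = val x) ∧
      (∀ q, k₁ q ≤ n ∧ k₂ q ≤ n) ∧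
      ∀ (q : ℕ) (u v : Fin n), k₁ q = u → k₂ q = v → (u, v) ∈ S := by
  classical
  have h : ∀ q, ∃ o : Option (Fin n × Fin n), (∀ x, o = some x → x ∈ S) ∧
      ∀ x ∈ S, addr x = q → o = some x := by
    intro q
    by_cases hq : ∃ x ∈ S, addr x = q
    · obtain ⟨x, hx, hxq⟩ := hq
      refine ⟨some x, fun y hy => Option.some.inj hy ▸ hx, fun y hy hyq => ?_⟩
      rw [hinj x hx y hy (hxq.trans hyq.symm)]
    · exact ⟨none, by simp, fun x hx hxq => absurd ⟨x, hx, hxq⟩ hq⟩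
  choose o ho ho' using h
  refine ⟨fun q => (o q).elim n fun x => x.1, fun q => (o q).elim n fun x => x.2,
    fun q => (o q).elim 0 val, fun x hx => ?_, fun q => ?_, fun q u v h1 h2 => ?_⟩
  · simp [ho' _ x hx rfl]
  · rcases hoq : o q with _ | x
    · simp [hoq]
    · simp [hoq, x.1.2.le, x.2.2.le]
  · rcases hoq : o q with _ | x
    · simp only [hoq, Option.elim_none] at h1
      exact absurd h1 u.2.ne'
    · simp only [hoq, Option.elim_some] at h1 h2
      have : x = (u, v) := Prod.ext (Fin.ext h1) (Fin.ext h2)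
      exact this ▸ ho q x hoq

theorem exists_nearest_landmark {V : Type*} (d : V → V → ℕ∞) (A : Finset V) [Nonempty V] :
    ∃ (landmark : ℕ → V) (nearest : V → ℕ), A.Nonempty → ∀ u, nearest u < A.card ∧
      landmark (nearest u) ∈ A ∧ ∀ a ∈ A, d (landmark (nearest u)) u ≤ d a u := by
  classical
  rcases A.eq_empty_or_nonempty with rfl | hA
  · exact ⟨fun _ => Classical.arbitrary V, fun _ => 0, fun h => absurd h Finset.not_nonempty_empty⟩
  choose p hpA hp using fun u => A.exists_min_image (fun a => d a u) hA
  refine ⟨fun j => if h : j < A.card then A.equivFin.symm ⟨j, h⟩ else Classical.arbitrary V,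
    fun u => A.equivFin ⟨p u, hpA u⟩, fun _ u => ⟨Fin.is_lt _, ?_⟩⟩
  simp only [Fin.is_lt, dite_true, Fin.eta, Equiv.symm_apply_apply]
  exact ⟨hpA u, hp u⟩

/-- The estimate that the landmarks give for a pair that is not near. -/
theorem hasStretch_landmark_estimate {V : Type*} [Fintype V] [DecidableEq V] {G : SimpleGraph V}
    {A : Finset V} {k w : ℕ} (hw : 2 * Fintype.card V < 2 ^ w) {u v a b : V}
    (h : (u, v) ∉ nearPairs G A k) (haA : a ∈ A)
    (ha : ∀ a' ∈ A, G.edist a u ≤ G.edist a' u) (hb : ∀ a' ∈ A, G.edist b v ≤ G.edist a' v) :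
    (encodeDistance w (G.edist a u) ≠ 2 ^ w - 1 → encodeDistance w (G.edist a v) ≠ 2 ^ w - 1 →
      encodeDistance w (G.edist a u) + encodeDistance w (G.edist a v) < 2 ^ w ∧
      encodeDistance w (G.edist b v) + encodeDistance w (G.edist b u) < 2 ^ w) ∧
    HasStretch 2 (1 - (k : ℝ)) (G.edist u v) (toDistance
      (if encodeDistance w (G.edist a u) = 2 ^ w - 1 ∨ encodeDistance w (G.edist a v) = 2 ^ w - 1
        then BitVec.allOnes w
        else BitVec.ofNat w (min (encodeDistance w (G.edist a u) + encodeDistance w (G.edist a v))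
          (encodeDistance w (G.edist b v) + encodeDistance w (G.edist b u))))) := by
  have htop : ∀ {x y z : V}, G.edist x y ≠ ⊤ → G.edist y z ≠ ⊤ → G.edist x z ≠ ⊤ := by
    intro x y z h1 h2
    rw [SimpleGraph.edist_ne_top_iff_reachable] at *
    exact h1.trans h2
  have hsymm : ∀ {x y : V}, G.edist x y ≠ ⊤ → G.edist y x ≠ ⊤ := by
    intro x y h1
    rwa [SimpleGraph.edist_comm]
  have hlt : ∀ {x y : V} {m : ℕ}, (m : ℕ∞) = G.edist x y → m < Fintype.card V := by
    intro x y m hm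
    have := SimpleGraph.edist_lt_card (G := G) (u := x) (v := y)
      (hm ▸ ENat.natCast_ne_top m)
    rw [← hm] at this
    exact_mod_cast this
  by_cases hfin : G.edist a u ≠ ⊤ ∧ G.edist a v ≠ ⊤
  · obtain ⟨hau, hav⟩ := hfin
    have hbv : G.edist b v ≠ ⊤ := ne_top_of_le_ne_top hav (hb a haA)
    have huv : G.edist u v ≠ ⊤ := htop (hsymm hau) hav
    have hbu : G.edist b u ≠ ⊤ := htop hbv (hsymm huv)
    obtain ⟨r, hr⟩ := ENat.ne_top_iff_exists.1 hau
    obtain ⟨x, hx⟩ := ENat.ne_top_iff_exists.1 hav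
    obtain ⟨s, hs⟩ := ENat.ne_top_iff_exists.1 hbv
    obtain ⟨y, hy⟩ := ENat.ne_top_iff_exists.1 hbu
    obtain ⟨m, hm⟩ := ENat.ne_top_iff_exists.1 huv
    have h1 := hlt hr
    have h2 := hlt hx
    have h3 := hlt hs
    have h4 := hlt hy
    simp only [← hr, ← hx, ← hs, ← hy, ← hm, encodeDistance_natCast]
    refine ⟨fun _ _ => ⟨by omega, by omega⟩, ?_⟩
    rw [if_neg (by omega), toDistance_ofNat (by omega)]
    have tri : ∀ {p q t : V} {i j l : ℕ}, (i : ℕ∞) = G.edist p q → (j : ℕ∞) = G.edist q t →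
        (l : ℕ∞) = G.edist p t → l ≤ i + j := by
      intro p q t i j l hi hj hl
      have := SimpleGraph.edist_triangle (G := G) (u := p) (v := q) (w := t)
      rw [← hi, ← hj, ← hl] at this
      exact_mod_cast this
    have hr' : (r : ℕ∞) = G.edist u a := by rw [hr, SimpleGraph.edist_comm]
    have hy' : (y : ℕ∞) = G.edist u b := by rw [hy, SimpleGraph.edist_comm]
    have hm' : (m : ℕ∞) = G.edist v u := by rw [hm, SimpleGraph.edist_comm]
    have t1 := tri hr' hx hm
    have t2 := tri hy' hs hm
    have t3 := tri hr hm hx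
    have t4 := tri hs hm' hy
    refine ⟨by exact_mod_cast (by omega : m ≤ min (r + x) (s + y)), fun m' hmm' => ?_⟩
    have hmm : m = m' := by exact_mod_cast hmm'
    subst hmm
    refine ⟨_, rfl, ?_⟩
    obtain ⟨a', ha', q, hq, hau' | hav'⟩ := exists_landmark_of_notMem_nearPairs h hm.symm
    · have hle : r ≤ q := by
        have := ha a' ha'
        rw [← hr, hau'] at this
        exact_mod_cast this
      rcases hq with hq | hq
      · refine le_max_of_le_left ?_
        exact_mod_cast (by omega : min (r + x) (s + y) ≤ m)
      · refine le_max_of_le_right ?_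
        have : min (r + x) (s + y) + k ≤ 2 * m + 1 := by omega
        have : ((min (r + x) (s + y) : ℕ) : ℝ) + k ≤ 2 * m + 1 := by exact_mod_cast this
        linarith
    · have hle : s ≤ q := by
        have := hb a' ha'
        rw [← hs, hav'] at this
        exact_mod_cast this
      rcases hq with hq | hq
      · refine le_max_of_le_left ?_
        exact_mod_cast (by omega : min (r + x) (s + y) ≤ m)
      · refine le_max_of_le_right ?_
        have : min (r + x) (s + y) + k ≤ 2 * m + 1 := by omega
        have : ((min (r + x) (s + y) : ℕ) : ℝ) + k ≤ 2 * m + 1 := by exact_mod_cast this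
        linarith
  · have hor : encodeDistance w (G.edist a u) = 2 ^ w - 1 ∨
        encodeDistance w (G.edist a v) = 2 ^ w - 1 := by
      rcases not_and_or.1 hfin with h' | h'
      · rw [not_not.1 h', encodeDistance_top]; exact .inl rfl
      · rw [not_not.1 h', encodeDistance_top]; exact .inr rfl
    refine ⟨fun h1 h2 => absurd hor (not_or.2 ⟨h1, h2⟩), ?_⟩
    rw [if_pos hor, toDistance_allOnes]
    have huv : G.edist u v = ⊤ := by
      by_contra huv
      obtain ⟨m, hm⟩ := ENat.ne_top_iff_exists.1 huv
      obtain ⟨a', ha', q, -, hq⟩ := exists_landmark_of_notMem_nearPairs h hm.symm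
      have hau' : G.edist a' u ≠ ⊤ := by
        rcases hq with hq | hq
        · rw [hq]; exact ENat.natCast_ne_top _
        · exact htop (hq ▸ ENat.natCast_ne_top _) (hsymm huv)
      have hau := ne_top_of_le_ne_top hau' (ha a' ha')
      exact hfin ⟨hau, htop hau huv⟩
    rw [huv]
    exact hasStretch_self _ _ _

theorem nearPairs_empty {V : Type*} [Fintype V] [DecidableEq V] (G : SimpleGraph V) (k : ℕ)
    (p : V × V) : p ∈ nearPairs G ∅ k :=
  mem_nearPairs.2 ⟨p.1, p.1, by simp, by simp, by simp⟩

theorem const_mul_sq_le_two_pow {n : ℕ} (hn : 0 < n) :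
    112 * n ^ 2 ≤ 2 ^ (10 * (Nat.log 2 n + 1)) := by
  have h1 : n < 2 ^ (Nat.log 2 n + 1) := Nat.lt_pow_succ_log_self (by norm_num) n
  set X := 2 ^ (Nat.log 2 n + 1) with hX
  have h2 : 2 ≤ X := by omega
  rw [mul_comm 10, pow_mul, ← hX]
  calc 112 * n ^ 2 ≤ 2 ^ 8 * X ^ 2 := by gcongr; norm_num
    _ ≤ X ^ 8 * X ^ 2 := by gcongr
    _ = X ^ 10 := by ring

/-- The oracle built from a set of landmarks. -/
theorem exists_distanceOracle {n : ℕ} (hn : 0 < n) (G : SimpleGraph (Fin n)) (A : Finset (Fin n))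
    (k : ℕ) : ∃ D : List (BitVec (10 * (Nat.log 2 n + 1))),
      D.length = 16 * (4 * (nearPairs G A k).card + 1 + (A.card + 1) * n) ∧
      IsDistanceOracle G distanceProgram D 80 2 (1 - (k : ℝ)) := by
  have : NeZero n := ⟨hn.ne'⟩
  set w := 10 * (Nat.log 2 n + 1) with hw
  set S := nearPairs G A k with hS
  obtain ⟨a, c, b, e, δ, ha, hb, hc, he, hδ, hinj⟩ := exists_perfect_hash S
  obtain ⟨k₁, k₂, value, hkeys, hkle, hkmem⟩ := exists_hash_arrays S
    (fun x => δ (a x.1 + b x.2) + (c x.1 + e x.2))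
    (fun x => encodeDistance w (G.edist x.1 x.2)) hinj
  obtain ⟨landmark, nearest, hnear⟩ := exists_nearest_landmark G.edist A
  set l := 4 * S.card + 1 + (A.card + 1) * n with hl
  have hwn : 112 * n ^ 2 ≤ 2 ^ w := const_mul_sq_le_two_pow hn
  have hnn : n ≤ n ^ 2 := Nat.le_self_pow (by norm_num) n
  have hSn : S.card ≤ n ^ 2 := by
    refine (Finset.card_le_univ S).trans_eq ?_
    rw [Fintype.card_prod, Fintype.card_fin, sq]
  have hAn : A.card * n ≤ n ^ 2 := by
    rw [sq]
    exact Nat.mul_le_mul_right _ ((Finset.card_le_univ A).trans_eq (Fintype.card_fin n))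
  have hln : l = 4 * S.card + 1 + A.card * n + n := by rw [hl]; ring
  have hl16 : 16 * l ≤ 2 ^ w := by omega
  have hdist : ∀ x y : Fin n, G.edist x y ≠ ⊤ → G.edist x y < (2 ^ w - 1 : ℕ) := by
    intro x y hxy
    refine (SimpleGraph.edist_lt_card hxy).trans_le ?_
    rw [Fintype.card_fin]
    exact_mod_cast (by omega : n ≤ 2 ^ w - 1)
  have henc : ∀ x y : Fin n, encodeDistance w (G.edist x y) < 2 ^ w := by
    intro x y
    by_cases hxy : G.edist x y = ⊤
    · rw [hxy, encodeDistance_top]; omega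
    · obtain ⟨m, hm⟩ := ENat.ne_top_iff_exists.1 hxy
      have := hdist x y hxy
      rw [← hm] at this ⊢
      rw [encodeDistance_natCast]
      have : m < 2 ^ w - 1 := by exact_mod_cast this
      omega
  set F : ℕ → ℕ → ℕ := fun s i => match s with
    | 0 => a (Fin.ofNat n i)
    | 1 => b (Fin.ofNat n i)
    | 2 => c (Fin.ofNat n i)
    | 3 => e (Fin.ofNat n i)
    | 4 => δ i
    | 5 => k₁ i
    | 6 => k₂ i
    | 7 => value i
    | 8 => encodeDistance w (G.edist (landmark (nearest (Fin.ofNat n i))) (Fin.ofNat n i))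
    | 9 => nearest (Fin.ofNat n i) * n
    | 10 => encodeDistance w (G.edist (landmark (i / n)) (Fin.ofNat n i))
    | _ => 0 with hF
  have hofNat : ∀ u : Fin n, Fin.ofNat n (u : ℕ) = u := fun u => by
    ext; simp
  have F0 : ∀ u : Fin n, F 0 u = a u := fun u => congrArg a (hofNat u)
  have F1 : ∀ u : Fin n, F 1 u = b u := fun u => congrArg b (hofNat u)
  have F2 : ∀ u : Fin n, F 2 u = c u := fun u => congrArg c (hofNat u)
  have F3 : ∀ u : Fin n, F 3 u = e u := fun u => congrArg e (hofNat u)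
  have F8 : ∀ u : Fin n, F 8 u = encodeDistance w (G.edist (landmark (nearest u)) u) := fun u =>
    congrArg (fun u => encodeDistance w (G.edist (landmark (nearest u)) u)) (hofNat u)
  have F9 : ∀ u : Fin n, F 9 u = nearest u * n := fun u =>
    congrArg (fun u => nearest u * n) (hofNat u)
  have F10 : ∀ u v : Fin n, F 10 (F 9 u + v) =
      encodeDistance w (G.edist (landmark (nearest u)) v) := by
    intro u v
    have h1 : (F 9 u + v) / n = nearest u := by
      rw [F9, mul_comm, Nat.mul_add_div hn, Nat.div_eq_of_lt v.2, add_zero]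
    have h2 : Fin.ofNat n (F 9 u + v) = v := by
      ext
      rw [F9, mul_comm]
      simp [Nat.mod_eq_of_lt v.2]
    change encodeDistance w (G.edist (landmark ((F 9 u + v) / n)) (Fin.ofNat n (F 9 u + v))) = _
    rw [h1, h2]
  refine ⟨sectionMemory w l F, length_sectionMemory w l F, fun u v => ?_⟩
  have hu : (u : ℕ) < l := by have := u.2; omega
  have hv : (v : ℕ) < l := by have := v.2; omega
  have hau := ha u
  have hbv := hb v
  have hcu := hc u
  have hev := he v
  have hg : F 0 u + F 1 v < l := by rw [F0, F1]; omega
  have hqF : F 4 (F 0 u + F 1 v) + (F 2 u + F 3 v) = δ (a u + b v) + (c u + e v) := by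
    rw [F0, F1, F2, F3]
    rfl
  have hδuv := hδ (a u + b v)
  have hq : δ (a u + b v) + (c u + e v) < l := by omega
  by_cases huv : (u, v) ∈ S
  · obtain ⟨h5, h6, h7⟩ := hkeys _ huv
    refine ⟨_, query_of_mem_table hl16 hu hv hg hq hqF h5 h6, ?_⟩
    have h7' : F 7 (δ (a u + b v) + (c u + e v)) = encodeDistance w (G.edist u v) := h7
    rw [h7', toDistance_encodeDistance (hdist u v)]
    exact hasStretch_self _ _ _
  · have hA : A.Nonempty := by
      rw [Finset.nonempty_iff_ne_empty]
      intro h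
      rw [hS, h] at huv
      exact huv (nearPairs_empty G k _)
    obtain ⟨hju, hpu, hminu⟩ := hnear hA u
    obtain ⟨hjv, -, hminv⟩ := hnear hA v
    obtain ⟨hsum, hstretch⟩ := hasStretch_landmark_estimate (w := w)
      (by rw [Fintype.card_fin]; omega) huv hpu hminu hminv
    rw [← F8 u, ← F8 v, ← F10 u v, ← F10 v u] at hsum hstretch
    have hrow : ∀ x y : Fin n, nearest x < A.card → F 9 x + y < l := by
      intro x y hx
      have h1 : (nearest x + 1) * n ≤ A.card * n := Nat.mul_le_mul_right _ hx
      rw [add_mul, one_mul] at h1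
      rw [F9]
      have := y.2
      omega
    have hk := hkle (δ (a u + b v) + (c u + e v))
    refine ⟨_, query_of_notMem_table hl16 hu hv hg hq hqF ?_ ?_ (fun h => huv ?_)
      (hrow u v hju) (hrow v u hjv) ?_ ?_ hsum, hstretch⟩
    · exact hk.1.trans_lt (by omega)
    · exact hk.2.trans_lt (by omega)
    · exact hkmem _ u v h.1 h.2
    · rw [F8]; exact henc _ _
    · rw [F10]; exact henc _ _

end Oracle

end WordRAM

/-- Landmarks for which the oracle has the claimed size. -/
theorem exists_landmarks_space_le {n : ℕ} (hn : 0 < n) (G : SimpleGraph (Fin n))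
    [DecidableRel G.Adj] {k : ℕ} {c ε : ℝ} (hk : 1 ≤ k) (hε : 0 < ε)
    (hεk : ε ≤ 1 / (k : ℝ))
    (hΔ : (G.maxDegree : ℝ) ≤ c * (n : ℝ) ^ (1 / (k : ℝ) - ε)) :
    ∃ A : Finset (Fin n),
      ((16 * (4 * (nearPairs G A k).card + 1 + (A.card + 1) * n) : ℕ) : ℝ) ≤
        640 * (max 1 (c ^ k) * (n : ℝ) ^ (2 - (k : ℝ) * ε / 3) * (1 + Real.log (n : ℝ)) ^ 1) := by
  have : Nonempty (Fin n) := ⟨⟨0, hn⟩⟩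
  have hk0 : (0 : ℝ) < k := by exact_mod_cast hk
  have hn1 : (1 : ℝ) ≤ n := by exact_mod_cast hn
  have hn0 : (0 : ℝ) < n := by linarith
  have hkε : (k : ℝ) * ε ≤ 1 := by
    rw [le_div_iff₀ hk0] at hεk
    linarith
  have hkε0 : 0 < (k : ℝ) * ε := mul_pos hk0 hε
  set y := (n : ℝ) ^ ((k : ℝ) * ε / 3) with hy
  have hy1 : 1 ≤ y := Real.one_le_rpow hn1 (by positivity)
  set M := ⌈y⌉₊ with hM
  have hyM : y ≤ M := Nat.le_ceil y
  have hM2 : (M : ℝ) ≤ 2 * y := by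
    have := Nat.ceil_lt_add_one (zero_le_one.trans hy1)
    linarith
  obtain ⟨A, hA, hcl⟩ := exists_landmarks G.edist (M := M) (Nat.ceil_pos.2 (by linarith))
  refine ⟨A, ?_⟩
  have hN := card_nearPairs_le hcl (k := k)
  rw [Fintype.card_fin] at hN hA
  set X := (n : ℝ) ^ (2 - (k : ℝ) * ε / 3) with hX
  set B := max 1 (c ^ k) with hB
  set Λ := Real.log (n : ℝ) with hΛ
  have hΛ0 : 0 ≤ Λ := Real.log_nonneg hn1
  have hB1 : 1 ≤ B := le_max_left _ _
  have hXy : X * y = n * n := by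
    rw [hX, hy, ← Real.rpow_add hn0, sub_add_cancel, ← sq]
    exact_mod_cast Real.rpow_natCast (n : ℝ) 2
  have hnX : (n : ℝ) ≤ X := by
    conv_lhs => rw [← Real.rpow_one (n : ℝ)]
    exact Real.rpow_le_rpow_of_exponent_le hn1 (by linarith)
  set z := (n : ℝ) ^ (1 - (k : ℝ) * ε) with hz
  have hz1 : 1 ≤ z := Real.one_le_rpow hn1 (by linarith)
  have hdeg : (max 1 ((G.maxDegree : ℝ) ^ k)) ≤ B * z := by
    refine max_le ?_ ?_
    · nlinarith
    · calc (G.maxDegree : ℝ) ^ k ≤ (c * (n : ℝ) ^ (1 / (k : ℝ) - ε)) ^ k := by gcongr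
        _ = c ^ k * z := by
          rw [mul_pow, ← Real.rpow_natCast ((n : ℝ) ^ _), ← Real.rpow_mul hn0.le, hz]
          congr 2
          field_simp
        _ ≤ B * z := by gcongr; exact le_max_right _ _
  have hnzy : n * z * (y * y) = X := by
    rw [hz, hy, hX, ← Real.rpow_add hn0]
    conv_lhs => rw [← Real.rpow_one (n : ℝ)]
    rw [← Real.rpow_mul hn0.le, ← Real.rpow_mul hn0.le, ← Real.rpow_add hn0,
      ← Real.rpow_add hn0]
    congr 1
    ring
  have hNX : ((nearPairs G A k).card : ℝ) ≤ 8 * (B * X) := by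
    calc ((nearPairs G A k).card : ℝ)
        ≤ n * ((2 * max 1 ((G.maxDegree : ℝ) ^ k)) * (M * M)) := by exact_mod_cast hN
      _ ≤ n * ((2 * (B * z)) * ((2 * y) * (2 * y))) := by gcongr
      _ = 8 * (B * (n * z * (y * y))) := by ring
      _ = 8 * (B * X) := by rw [hnzy]
  have hAX : (A.card : ℝ) * n ≤ 4 * (X * Λ) + X := by
    have h1 : (4 * n * Λ / M : ℝ) ≤ 4 * n * Λ / y := by gcongr
    calc (A.card : ℝ) * n ≤ (4 * n * Λ / y + 1) * n := by gcongr; linarith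
      _ = 4 * (n * n) * Λ / y + n := by ring
      _ = 4 * (X * Λ) + n := by rw [← hXy]; field_simp
      _ ≤ 4 * (X * Λ) + X := by linarith
  have hX1 : 1 ≤ X := hn1.trans hnX
  have hBX : X ≤ B * X := le_mul_of_one_le_left (by linarith) hB1
  have hBXΛ : X * Λ ≤ B * X * Λ := mul_le_mul_of_nonneg_right hBX hΛ0
  have hBXΛ0 : 0 ≤ B * X * Λ := by positivity
  push_cast
  rw [pow_one]
  nlinarith

theorem theorem1 :
    ∃ (P : WordRAM.Program) (t b a : ℕ) (C : ℝ),
      ∀ (n : ℕ) (G : SimpleGraph (Fin n)) [DecidableRel G.Adj] (k : ℕ) (c ε : ℝ),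
        1 ≤ k → 0 < c → 0 < ε → ε ≤ 1 / (k : ℝ) →
        (G.maxDegree : ℝ) ≤ c * (n : ℝ) ^ (1 / (k : ℝ) - ε) →
        ∃ D : List (BitVec (b * (Nat.log 2 n + 1))),
          (D.length : ℝ) ≤
              C * (max 1 (c ^ k) * (n : ℝ) ^ (2 - (k : ℝ) * ε / 3) * (1 + Real.log (n : ℝ)) ^ a) ∧
            WordRAM.IsDistanceOracle G P D t 2 (1 - (k : ℝ)) := by
  refine ⟨WordRAM.distanceProgram, 80, 10, 1, 640, ?_⟩
  intro n G _ k c ε hk _ hε hεk hΔ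
  rcases Nat.eq_zero_or_pos n with rfl | hn
  · refine ⟨[], ?_, fun u => u.elim0⟩
    simp only [List.length_nil, Nat.cast_zero, Real.log_zero]
    positivity
  · obtain ⟨A, hA⟩ := exists_landmarks_space_le hn G hk hε hεk hΔ
    obtain ⟨D, hD, horacle⟩ := WordRAM.exists_distanceOracle hn G A k
    exact ⟨D, by rw [hD]; exact hA, horacle⟩
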